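/- Let $\alpha>1$ and $c_1>0$. Then there is a constant $C=C(c_1,\alpha)>0$, depending only on $c_1$ and $\alpha$, such that the following holds. Let $u>0$, and let $\rho$ be a probability distribution on $[1,\infty)$ with $$c_1^{-1}r^{-\alpha}\le\rho[r,\infty)\le c_1r^{-\alpha}\qquad\text{for every } r\ge 1.$$ Put $S=\mathbb{R}^2\times[1,\infty)\times(-\pi/2,\pi/2]$, and for $s=(z,R,V)\in S$ let $E(s)\subset\mathbb{R}^2$ be the filled closed ellipse with centre $z$, major semi-axis $R$ in the direction $(\cos V,\sin V)$, and minor semi-axis $1$. Let $\xi$ be the $(u,\rho)$-ellipses model, that is, the Poisson point process on $S$ with intensity measure $(u\lambda)\otimes\rho\otimes\nu$, where $\lambda$ is Lebesgue measure on $\mathbb{R}^2$ and $\nu$ is the uniform distribution on $(-\pi/2,\pi/2]$. For a locally finite point configuration $\eta=\sum_i\delta_{s_i}$ on $S$ and $K\subset\mathbb{R}^2$, let $\eta_K=\sum_{i:\,E(s_i)\cap K\ne\varnothing}\delta_{s_i}$. A function $f$ of configurations is said to depend only on the ellipses touching $K$ if $f(\eta)=f(\eta_K)$ for every configuration $\eta$.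 Let $l_1\ge 1$, $a\ge 3$, $l_2=a\,l_1$, $K_1=B(l_1)$ and $K_2=B(l_2)^c$, where $B(l)$ is the closed Euclidean ball of radius $l$ centred at the origin. Let $f_1,f_2$ be measurable real functions of configurations with $|f_1|\le1$ and $|f_2|\le 1$, such that $f_j$ depends only on the ellipses touching $K_j$ for $j=1,2$. Then $$\bigl|E[f_1(\xi)f_2(\xi)]-E[f_1(\xi)]\,E[f_2(\xi)]\bigr|\le u\,C\,l_1^{2-\alpha}(a-1)^{1-\alpha}.$$ -/

import Mathlib

open MeasureTheory ProbabilityTheory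
open scoped ENNReal NNReal

/-- The Euclidean plane. -/
abbrev Plane : Type := EuclideanSpace ℝ (Fin 2)

/-- The parameter space `S = ℝ² × [1, ∞) × (-π/2, π/2]` of the ellipses: centre, major semi-axis,
direction of the major axis. -/
abbrev EllipseParam : Type :=
  Plane × Set.Ici (1 : ℝ) × Set.Ioc (-(Real.pi / 2)) (Real.pi / 2)

/-- The filled closed ellipse `E(z, R, V)` with centre `z`, major semi-axis `R` in the direction
`(cos V, sin V)` and minor semi-axis `1`. -/
def ellipse (s : EllipseParam) : Set Plane :=
  {w | (((w 0 - s.1 0) * Real.cos s.2.2 + (w 1 - s.1 1) * Real.sin s.2.2) / (s.2.1 : ℝ)) ^ 2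
      + (-(w 0 - s.1 0) * Real.sin s.2.2 + (w 1 - s.1 1) * Real.cos s.2.2) ^ 2 ≤ 1}

/-- The set of parameters whose ellipse touches `K`. -/
def touching (K : Set Plane) : Set EllipseParam :=
  {s | (ellipse s ∩ K).Nonempty}

/-- The uniform distribution `ν` on the directions `(-π/2, π/2]`. -/
noncomputable def directionLaw : Measure (Set.Ioc (-(Real.pi / 2)) (Real.pi / 2)) :=
  (ENNReal.ofReal Real.pi)⁻¹ • (volume : Measure ℝ).comap Subtype.val

/-- `ρ` has tail decay `α` with associated constant `c`:
`c⁻¹ r^{-α} ≤ ρ[r, ∞) ≤ c r^{-α}` for every `r ≥ 1`. -/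
def HasTailDecay (ρ : Measure (Set.Ici (1 : ℝ))) (α c : ℝ) : Prop :=
  ∀ r : ℝ, 1 ≤ r →
    c⁻¹ * r ^ (-α) ≤ ρ.real {x | r ≤ (x : ℝ)} ∧ ρ.real {x | r ≤ (x : ℝ)} ≤ c * r ^ (-α)

/-- A point measure: a countable sum of Dirac masses. The index set is a set of natural numbers,
so finite and empty sums are included. -/
def IsPointMeasure {S : Type*} [MeasurableSpace S] (m : Measure S) : Prop :=
  ∃ (I : Set ℕ) (s : I → S), m = Measure.sum (fun i : I => Measure.dirac (s i))

/-- The space of point configurations on `S`: locally finite point measures, with the σ-algebra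
generated by the evaluations `m ↦ m A` at measurable sets `A`. -/
abbrev PointConfig (S : Type*) [MeasurableSpace S] [TopologicalSpace S] : Type _ :=
  {m : Measure S // IsPointMeasure m ∧ IsLocallyFiniteMeasure m}

theorem IsPointMeasure.restrict {S : Type*} [MeasurableSpace S] [MeasurableSingletonClass S]
    {m : Measure S} (hm : IsPointMeasure m) (T : Set S) : IsPointMeasure (m.restrict T) := by
  classical
  obtain ⟨I, s, rfl⟩ := hm
  refine ⟨{n | ∃ h : n ∈ I, s ⟨n, h⟩ ∈ T}, fun i => s ⟨i.1, i.2.1⟩, ?_⟩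
  rw [Measure.restrict_sum_of_countable]
  simp only [MeasureTheory.restrict_dirac]
  ext A hA
  rw [Measure.sum_apply _ hA, Measure.sum_apply _ hA]
  let e : {n | ∃ h : n ∈ I, s ⟨n, h⟩ ∈ T} → I := fun i => ⟨i.1, i.2.1⟩
  have he : Function.Injective e := by
    intro x y h
    exact Subtype.ext (congrArg (fun z : I => z.1) h)
  have hsupp : Function.support
      (fun i : I => (if s i ∈ T then Measure.dirac (s i) else (0 : Measure S)) A)
      ⊆ Set.range e := by
    intro i hi
    by_cases h : s i ∈ T
    · exact ⟨⟨i.1, i.2, h⟩, rfl⟩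
    · simp [h] at hi
  rw [← he.tsum_eq hsupp]
  refine tsum_congr fun i => ?_
  have h : s (e i) ∈ T := i.2.2
  simp only [h, if_true]
  rfl

/-- The configuration obtained from `m` by keeping only the points that lie in `T`. -/
noncomputable def PointConfig.restrict {S : Type*} [MeasurableSpace S] [TopologicalSpace S]
    [MeasurableSingletonClass S] (m : PointConfig S) (T : Set S) : PointConfig S :=
  ⟨m.1.restrict T, m.2.1.restrict T, by
    have := m.2.2
    exact Measure.isLocallyFiniteMeasure_of_le Measure.restrict_le_self⟩

/-- `ξ` is a Poisson point process on `S` with intensity measure `μ`, under `P`: the number of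
points in a measurable set `A` is Poisson with mean `μ A` (almost surely infinite if `μ A = ∞`),
and the numbers of points in finitely many pairwise disjoint measurable sets are independent. -/
structure IsPoissonPointProcess {Ω S : Type*} [MeasurableSpace Ω] [MeasurableSpace S]
    [TopologicalSpace S] (ξ : Ω → PointConfig S) (μ : Measure S) (P : Measure Ω) : Prop where
  measurable : Measurable ξ
  law_of_lt_top : ∀ A : Set S, MeasurableSet A → μ A < ∞ →
    P.map (fun ω => (ξ ω).1 A) =
      (poissonMeasure (μ A).toNNReal).map (fun k : ℕ => (k : ℝ≥0∞))
  law_of_eq_top : ∀ A : Set S, MeasurableSet A → μ A = ∞ → ∀ᵐ ω ∂P, (ξ ω).1 A = ∞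
  indep : ∀ (n : ℕ) (A : Fin n → Set S), (∀ i, MeasurableSet (A i)) →
    Pairwise (Function.onFun Disjoint A) → iIndepFun (fun i ω => (ξ ω).1 (A i)) P

/-- The intensity measure `(u λ) ⊗ ρ ⊗ ν` of the `(u, ρ)`-ellipses model. -/
noncomputable def ellipsesIntensity (u : ℝ) (ρ : Measure (Set.Ici (1 : ℝ))) :
    Measure EllipseParam :=
  (ENNReal.ofReal u • (volume : Measure Plane)).prod (ρ.prod directionLaw)

/-- `ξ` is a `(u, ρ)`-ellipses model under `P`. -/
def IsEllipsesModel {Ω : Type*} [MeasurableSpace Ω] (ξ : Ω → PointConfig EllipseParam)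
    (u : ℝ) (ρ : Measure (Set.Ici (1 : ℝ))) (P : Measure Ω) : Prop :=
  IsPoissonPointProcess ξ (ellipsesIntensity u ρ) P

/-- `f` depends only on the ellipses touching `K`: `f(ξ) = f(ξ_K)`, where `ξ_K` keeps only the
points of `ξ` whose ellipse intersects `K`. -/
def DependsOnlyOnTouching (f : PointConfig EllipseParam → ℝ) (K : Set Plane) : Prop :=
  ∀ ξ : PointConfig EllipseParam, f ξ = f (ξ.restrict (touching K))

/-! Let `T₁`, `T₂` be the parameter sets of ellipses touching the inner ball and the exterior of the
outer one, and `D = T₁ ∩ T₂`. Only ellipses in `D` couple the two functionals: if `D` carries no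
point, each `fⱼ` is unchanged when the process is restricted to `Tⱼ \ D`, and these restrictions
live on disjoint sets, hence are independent. Since `D` is occupied with probability at most `μ D`,
the covariance is at most `6 μ D` (`IsPoissonPointProcess.abs_covariance_le`).

It remains to bound `μ D`. An ellipse meeting both regions has major semi-axis `R ≥ r = (l₂ - l₁) /
2`, and its centre lies in a rotated rectangle of area at most `16 R l₁`
(`touching_inter_touching_subset`, `volume_rotated_rectangle`). Integrating `R` over `R ≥ r` against
the power tail gives order `r ^ (1 - α)` (`HasTailDecay.setLIntegral_le`), so `μ D` is at most of
order `u l₁ r ^ (1 - α)`, where `r = l₁ (a - 1) / 2`. -/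

/-! ### Poisson processes: independence of restrictions and the covariance bound. -/

section PointProcess

/-- The points that lie in exactly those sets of the family `A` that `t` selects. -/
def atomOf {S I : Type*} (A : I → Set S) (t : I → Bool) : Set S :=
  {x | ∀ i, x ∈ A i ↔ t i = true}

theorem disjoint_atomOf {S I : Type*} (A : I → Set S) {t t' : I → Bool} (h : t ≠ t') :
    Disjoint (atomOf A t) (atomOf A t') := by
  rw [Set.disjoint_left]
  intro x hx hx'
  refine h (funext fun i => ?_)
  exact Bool.eq_iff_iff.2 ((hx i).symm.trans (hx' i))

variable {Ω S : Type*} [MeasurableSpace Ω] [MeasurableSpace S]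

theorem measurableSet_atomOf {I : Type*} [Finite I] {A : I → Set S}
    (hA : ∀ i, MeasurableSet (A i)) (t : I → Bool) : MeasurableSet (atomOf A t) := by
  have h : atomOf A t = ⋂ i, {x | x ∈ A i ↔ t i = true} := by
    ext x
    simp [atomOf]
  rw [h]
  refine MeasurableSet.iInter fun i => ?_
  cases hi : t i
  · simp only [Bool.false_eq_true, iff_false]
    exact (hA i).compl
  · simpa using hA i

theorem measure_eq_sum_atomOf {I : Type*} [Fintype I] [DecidableEq I] {A : I → Set S}
    (hA : ∀ i, MeasurableSet (A i)) {T : Set S} (hT : MeasurableSet T) (m : Measure S) (i : I) :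
    m (A i ∩ T) = ∑ t : I → Bool, if t i = true then m (atomOf A t ∩ T) else 0 := by
  classical
  have h : A i ∩ T = ⋃ t ∈ Finset.univ.filter (fun t : I → Bool => t i = true),
      atomOf A t ∩ T := by
    ext x
    simp only [Set.mem_inter_iff, Finset.mem_filter, Finset.mem_univ, true_and, Set.mem_iUnion,
      exists_prop]
    constructor
    · rintro ⟨hx, hxT⟩
      exact ⟨fun j => decide (x ∈ A j), by simpa using hx, fun j => by simp, hxT⟩
    · rintro ⟨t, ht, hx, hxT⟩
      exact ⟨(hx i).2 ht, hxT⟩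
  rw [h, measure_biUnion_finset _ fun t _ => (measurableSet_atomOf hA t).inter hT,
    Finset.sum_filter]
  intro t _ t' _ htt
  exact (disjoint_atomOf A htt).mono Set.inter_subset_left Set.inter_subset_left

variable [TopologicalSpace S]

namespace IsPoissonPointProcess

variable {ξ : Ω → PointConfig S} {μ : Measure S} {P : Measure Ω}

theorem measurable_apply (h : IsPoissonPointProcess ξ μ P) {A : Set S} (hA : MeasurableSet A) :
    Measurable fun ω => (ξ ω).1 A :=
  (Measure.measurable_coe hA).comp (measurable_subtype_coe.comp h.measurable)

theorem iIndepFun_of_fintype (h : IsPoissonPointProcess ξ μ P) {ι : Type*} [Fintype ι]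
    {A : ι → Set S} (hA : ∀ i, MeasurableSet (A i)) (hd : Pairwise (Function.onFun Disjoint A)) :
    iIndepFun (fun i ω => (ξ ω).1 (A i)) P := by
  let e := Fintype.equivFin ι
  have h1 := h.indep (Fintype.card ι) (fun k => A (e.symm k)) (fun k => hA _)
    (fun k l hkl => hd fun hh => hkl (e.symm.injective hh))
  simpa using h1.precomp e.injective

/-- The defining independence covers only pairwise disjoint sets, whereas the `A i` may overlap. The
atoms of `A` inside `T` and of `B` inside `T'` form one disjoint family, and the two vectors of
counts are sums over disjoint groups of its cells. -/
theorem indepFun_finite_families (h : IsPoissonPointProcess ξ μ P) {I J : Type*} [Fintype I]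
    [Fintype J] {A : I → Set S} {B : J → Set S} (hA : ∀ i, MeasurableSet (A i))
    (hB : ∀ j, MeasurableSet (B j)) {T T' : Set S} (hT : MeasurableSet T)
    (hT' : MeasurableSet T') (hd : Disjoint T T') :
    IndepFun (fun ω i => (ξ ω).1 (A i ∩ T)) (fun ω j => (ξ ω).1 (B j ∩ T')) P := by
  classical
  let cell : (I → Bool) ⊕ (J → Bool) → Set S :=
    Sum.elim (fun t => atomOf A t ∩ T) (fun t => atomOf B t ∩ T')
  have hcell : ∀ k, MeasurableSet (cell k) := by
    rintro (t | t)
    · exact (measurableSet_atomOf hA t).inter hT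
    · exact (measurableSet_atomOf hB t).inter hT'
  have hdis : Pairwise (Function.onFun Disjoint cell) := by
    rintro (t | t) (t' | t') htt
    · exact (disjoint_atomOf A fun e => htt (by rw [e])).mono Set.inter_subset_left
        Set.inter_subset_left
    · exact hd.mono Set.inter_subset_right Set.inter_subset_right
    · exact hd.symm.mono Set.inter_subset_right Set.inter_subset_right
    · exact (disjoint_atomOf B fun e => htt (by rw [e])).mono Set.inter_subset_left
        Set.inter_subset_left
  let L : Finset ((I → Bool) ⊕ (J → Bool)) := Finset.univ.map Function.Embedding.inl
  let R : Finset ((I → Bool) ⊕ (J → Bool)) := Finset.univ.map Function.Embedding.inr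
  have hL : ∀ t, Sum.inl t ∈ L := fun t => by simp [L]
  have hR : ∀ t, Sum.inr t ∈ R := fun t => by simp [R]
  have hLR : Disjoint L R := by
    rw [Finset.disjoint_left]
    rintro (t | t) <;> simp [L, R]
  have hind := (h.iIndepFun_of_fintype hcell hdis).indepFun_finset L R hLR
    fun k => h.measurable_apply (hcell k)
  have hφ : Measurable fun (v : L → ℝ≥0∞) (i : I) =>
      ∑ t : I → Bool, if t i = true then v ⟨Sum.inl t, hL t⟩ else 0 := by
    refine measurable_pi_lambda _ fun i => Finset.measurable_sum _ fun t _ => ?_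
    split_ifs <;> fun_prop
  have hψ : Measurable fun (v : R → ℝ≥0∞) (j : J) =>
      ∑ t : J → Bool, if t j = true then v ⟨Sum.inr t, hR t⟩ else 0 := by
    refine measurable_pi_lambda _ fun i => Finset.measurable_sum _ fun t _ => ?_
    split_ifs <;> fun_prop
  convert hind.comp hφ hψ using 1
  · funext ω i
    exact measure_eq_sum_atomOf hA hT _ i
  · funext ω j
    exact measure_eq_sum_atomOf hB hT' _ j

/-- Configurations carry the σ-algebra generated by counts, so independence of the two count
processes suffices, and this reduces to finite families. -/
theorem indepFun_restrict [MeasurableSingletonClass S] [IsProbabilityMeasure P]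
    (h : IsPoissonPointProcess ξ μ P) {T T' : Set S} (hT : MeasurableSet T)
    (hT' : MeasurableSet T') (hd : Disjoint T T') :
    IndepFun (fun ω => (ξ ω).restrict T) (fun ω => (ξ ω).restrict T') P := by
  have hproc : IndepFun (fun ω (A : {A : Set S // MeasurableSet A}) => (ξ ω).1 (A.1 ∩ T))
      (fun ω (A : {A : Set S // MeasurableSet A}) => (ξ ω).1 (A.1 ∩ T')) P :=
    IndepFun.process_indepFun_process (fun A => h.measurable_apply (A.2.inter hT))
      (fun A => h.measurable_apply (A.2.inter hT')) fun I J =>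
        h.indepFun_finite_families (A := fun i : I => i.1.1) (B := fun j : J => j.1.1)
          (fun i => i.1.2) (fun j => j.1.2) hT hT' hd
  rw [IndepFun_iff_Indep] at hproc ⊢
  have key : ∀ T : Set S, MeasurableSet T →
      MeasurableSpace.comap (fun ω => (ξ ω).restrict T) inferInstance ≤
        MeasurableSpace.comap
          (fun ω (A : {A : Set S // MeasurableSet A}) => (ξ ω).1 (A.1 ∩ T)) inferInstance := by
    intro T hT
    rw [← measurable_iff_comap_le]
    refine Measurable.subtype_mk (f := fun ω => (ξ ω).1.restrict T) ?_
    refine Measure.measurable_of_measurable_coe _ fun A hA => ?_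
    simp_rw [Measure.restrict_apply hA]
    exact (measurable_pi_apply (X := fun _ : {A : Set S // MeasurableSet A} => ℝ≥0∞)
      ⟨A, hA⟩).comp (comap_measurable _)
  exact indep_of_indep_of_le_left (indep_of_indep_of_le_right hproc (key T' hT')) (key T hT)

/-- The void probability is `exp (-μ D)`, and `1 - exp (-x) ≤ x`. -/
theorem measureReal_ne_zero_le [IsProbabilityMeasure P] (h : IsPoissonPointProcess ξ μ P)
    {D : Set S} (hD : MeasurableSet D) (hμ : μ D < ∞) :
    P.real {ω | (ξ ω).1 D ≠ 0} ≤ (μ D).toReal := by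
  have hm := h.measurable_apply hD
  have h0 : P.real {ω | (ξ ω).1 D = 0} = Real.exp (-(μ D).toReal) := by
    have h1 : P {ω | (ξ ω).1 D = 0} = P.map (fun ω => (ξ ω).1 D) {0} := by
      rw [Measure.map_apply hm (measurableSet_singleton 0)]
      rfl
    have h2 : (fun k : ℕ => (k : ℝ≥0∞)) ⁻¹' {0} = {0} := by
      ext k
      simp
    rw [measureReal_def, h1, h.law_of_lt_top D hD hμ,
      Measure.map_apply (by fun_prop) (measurableSet_singleton 0), h2, ← measureReal_def,
      poissonMeasure_real_singleton]
    simp [ENNReal.toReal]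
  have h3 : {ω | (ξ ω).1 D ≠ 0} = {ω | (ξ ω).1 D = 0}ᶜ := rfl
  have h4 : MeasurableSet {ω | (ξ ω).1 D = 0} := hm (measurableSet_singleton 0)
  rw [h3, probReal_compl_eq_one_sub h4, h0]
  linarith [Real.add_one_le_exp (-(μ D).toReal)]

theorem measurable_restrict_comp [MeasurableSingletonClass S] (h : IsPoissonPointProcess ξ μ P)
    {T : Set S} (hT : MeasurableSet T) : Measurable fun ω => (ξ ω).restrict T := by
  refine Measurable.subtype_mk (f := fun ω => (ξ ω).1.restrict T) ?_
  refine Measure.measurable_of_measurable_coe _ fun A hA => ?_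
  simp_rw [Measure.restrict_apply hA]
  exact h.measurable_apply (hA.inter hT)

end IsPoissonPointProcess

theorem PointConfig.restrict_eq_of_diff_null [MeasurableSingletonClass S] (m : PointConfig S)
    {T U : Set S} (hUT : U ⊆ T) (h : m.1 (T \ U) = 0) : m.restrict T = m.restrict U := by
  refine Subtype.ext ?_
  refine Measure.restrict_congr_set ?_
  exact ((LE.le.eventuallyLE hUT).antisymm (ae_le_set.2 h)).symm

/-- Bounded functionals of the restrictions of a Poisson process to `T₁` and `T₂` have a covariance
controlled by the mean number of points in `T₁ ∩ T₂`. -/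
theorem IsPoissonPointProcess.abs_covariance_le [MeasurableSingletonClass S]
    {ξ : Ω → PointConfig S} {μ : Measure S} {P : Measure Ω} [IsProbabilityMeasure P]
    (h : IsPoissonPointProcess ξ μ P) {T₁ T₂ : Set S} (hT₁ : MeasurableSet T₁)
    (hT₂ : MeasurableSet T₂) (hμ : μ (T₁ ∩ T₂) < ∞) {f₁ f₂ : PointConfig S → ℝ}
    (hf₁ : Measurable f₁) (hf₂ : Measurable f₂) (hb₁ : ∀ m, |f₁ m| ≤ 1) (hb₂ : ∀ m, |f₂ m| ≤ 1)
    (hr₁ : ∀ m, f₁ m = f₁ (m.restrict T₁)) (hr₂ : ∀ m, f₂ m = f₂ (m.restrict T₂)) :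
    |(∫ ω, f₁ (ξ ω) * f₂ (ξ ω) ∂P) - (∫ ω, f₁ (ξ ω) ∂P) * (∫ ω, f₂ (ξ ω) ∂P)|
      ≤ 6 * (μ (T₁ ∩ T₂)).toReal := by
  set D := T₁ ∩ T₂ with hDdef
  have hD : MeasurableSet D := hT₁.inter hT₂
  set N : Set Ω := {ω | (ξ ω).1 D ≠ 0} with hN
  have hNm : MeasurableSet N := (h.measurable_apply hD) (measurableSet_singleton 0).compl
  have hNle : P.real N ≤ (μ D).toReal := h.measureReal_ne_zero_le hD hμ
  set F₁ : Ω → ℝ := fun ω => f₁ (ξ ω)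
  set F₂ : Ω → ℝ := fun ω => f₂ (ξ ω)
  set G₁ : Ω → ℝ := fun ω => f₁ ((ξ ω).restrict (T₁ \ D))
  set G₂ : Ω → ℝ := fun ω => f₂ ((ξ ω).restrict (T₂ \ D))
  have hF₁ : Measurable F₁ := hf₁.comp h.measurable
  have hF₂ : Measurable F₂ := hf₂.comp h.measurable
  have hG₁ : Measurable G₁ := hf₁.comp (h.measurable_restrict_comp (hT₁.diff hD))
  have hG₂ : Measurable G₂ := hf₂.comp (h.measurable_restrict_comp (hT₂.diff hD))
  have hdis : Disjoint (T₁ \ D) (T₂ \ D) := by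
    rw [Set.disjoint_left]
    rintro x ⟨hx, hxD⟩ ⟨hx', -⟩
    exact hxD ⟨hx, hx'⟩
  have hind : IndepFun G₁ G₂ P :=
    (h.indepFun_restrict (hT₁.diff hD) (hT₂.diff hD) hdis).comp hf₁ hf₂
  have hmul : ∫ ω, G₁ ω * G₂ ω ∂P = (∫ ω, G₁ ω ∂P) * ∫ ω, G₂ ω ∂P :=
    hind.integral_fun_mul_eq_mul_integral hG₁.aestronglyMeasurable hG₂.aestronglyMeasurable
  have int : ∀ F : Ω → ℝ, Measurable F → (∀ ω, |F ω| ≤ 1) → Integrable F P := fun F hF hb =>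
    Integrable.of_bound hF.aestronglyMeasurable 1 (ae_of_all _ hb)
  have bmul : ∀ F G : Ω → ℝ, (∀ ω, |F ω| ≤ 1) → (∀ ω, |G ω| ≤ 1) → ∀ ω, |F ω * G ω| ≤ 1 := by
    intro F G hF hG ω
    rw [abs_mul]
    exact mul_le_one₀ (hF ω) (abs_nonneg _) (hG ω)
  have babs : ∀ F : Ω → ℝ, (∀ ω, |F ω| ≤ 1) → |∫ ω, F ω ∂P| ≤ 1 := by
    intro F hb
    simpa using norm_integral_le_of_norm_le_const (μ := P) (f := F) (C := 1) (ae_of_all _ hb)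
  -- Functions bounded by `1` that agree off `N` differ by at most `2` on `N`.
  have comp : ∀ F G : Ω → ℝ, Measurable F → Measurable G → (∀ ω, |F ω| ≤ 1) →
      (∀ ω, |G ω| ≤ 1) → (∀ ω, ω ∉ N → F ω = G ω) →
      |(∫ ω, F ω ∂P) - ∫ ω, G ω ∂P| ≤ 2 * P.real N := by
    intro F G hF hG hbF hbG hFG
    rw [← integral_sub (int F hF hbF) (int G hG hbG)]
    have hb : ∀ ω, ‖F ω - G ω‖ ≤ N.indicator (fun _ => (2 : ℝ)) ω := by
      intro ω
      by_cases hω : ω ∈ N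
      · rw [Set.indicator_of_mem hω]
        refine (norm_sub_le _ _).trans ?_
        have h1 := hbF ω
        have h2 := hbG ω
        rw [Real.norm_eq_abs, Real.norm_eq_abs]
        linarith
      · rw [Set.indicator_of_notMem hω, hFG ω hω, sub_self, norm_zero]
    have h1 := norm_integral_le_of_norm_le ((integrable_const (2 : ℝ)).indicator hNm)
      (ae_of_all P hb)
    rw [integral_indicator_const _ hNm, smul_eq_mul, mul_comm] at h1
    exact h1
  have e₁ : ∀ ω, ω ∉ N → F₁ ω = G₁ ω := by
    intro ω hω
    have h0 : (ξ ω).1 D = 0 := not_not.1 hω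
    simp only [F₁, G₁]
    rw [hr₁ (ξ ω), PointConfig.restrict_eq_of_diff_null _ Set.sdiff_subset]
    exact measure_mono_null (by intro x; simp +contextual) h0
  have e₂ : ∀ ω, ω ∉ N → F₂ ω = G₂ ω := by
    intro ω hω
    have h0 : (ξ ω).1 D = 0 := not_not.1 hω
    simp only [F₂, G₂]
    rw [hr₂ (ξ ω), PointConfig.restrict_eq_of_diff_null _ Set.sdiff_subset]
    exact measure_mono_null (by intro x; simp +contextual) h0
  have c₁ := comp F₁ G₁ hF₁ hG₁ (fun _ => hb₁ _) (fun _ => hb₁ _) e₁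
  have c₂ := comp F₂ G₂ hF₂ hG₂ (fun _ => hb₂ _) (fun _ => hb₂ _) e₂
  have c₃ := comp (fun ω => F₁ ω * F₂ ω) (fun ω => G₁ ω * G₂ ω) (hF₁.mul hF₂) (hG₁.mul hG₂)
    (bmul _ _ (fun _ => hb₁ _) (fun _ => hb₂ _)) (bmul _ _ (fun _ => hb₁ _) (fun _ => hb₂ _))
    (fun ω hω => by simp only [e₁ ω hω, e₂ ω hω])
  have b₁ := babs F₁ (fun _ => hb₁ _)
  have b₂ := babs G₂ (fun _ => hb₂ _)
  -- Three replacements, each costing `2 * P.real N`, account for the constant `6`.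
  have split : (∫ ω, F₁ ω * F₂ ω ∂P) - (∫ ω, F₁ ω ∂P) * (∫ ω, F₂ ω ∂P) =
      ((∫ ω, F₁ ω * F₂ ω ∂P) - ∫ ω, G₁ ω * G₂ ω ∂P)
        - (∫ ω, F₁ ω ∂P) * ((∫ ω, F₂ ω ∂P) - ∫ ω, G₂ ω ∂P)
        - ((∫ ω, F₁ ω ∂P) - ∫ ω, G₁ ω ∂P) * ∫ ω, G₂ ω ∂P := by
    rw [hmul]
    ring
  rw [split]
  refine (abs_sub _ _).trans ?_
  refine (add_le_add_left (abs_sub _ _) _).trans ?_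
  rw [abs_mul, abs_mul]
  have m₁ := mul_le_mul b₁ c₂ (abs_nonneg _) zero_le_one
  have m₂ := mul_le_mul c₁ b₂ (abs_nonneg _) (by positivity)
  linarith

end PointProcess

/-! ### Geometry of the ellipses: measurability of the touching sets and location of the centres. -/

section EllipseGeometry

/-- The coordinate of `w` along the direction `V`. -/
noncomputable def alongCoord (V : ℝ) (w : Plane) : ℝ := w 0 * Real.cos V + w 1 * Real.sin V

/-- The coordinate of `w` perpendicular to the direction `V`. -/
noncomputable def acrossCoord (V : ℝ) (w : Plane) : ℝ := -w 0 * Real.sin V + w 1 * Real.cos V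

/-- The quadratic form whose unit sublevel set is the ellipse. -/
noncomputable def ellipseForm (s : EllipseParam) (w : Plane) : ℝ :=
  (alongCoord s.2.2 (w - s.1) / (s.2.1 : ℝ)) ^ 2 + acrossCoord s.2.2 (w - s.1) ^ 2

theorem mem_ellipse_iff {s : EllipseParam} {w : Plane} : w ∈ ellipse s ↔ ellipseForm s w ≤ 1 := by
  simp [ellipse, ellipseForm, alongCoord, acrossCoord]

theorem one_le_majorAxis (s : EllipseParam) : 1 ≤ (s.2.1 : ℝ) := s.2.1.2

@[fun_prop]
theorem Continuous.alongCoord {X : Type*} [TopologicalSpace X] {V : X → ℝ} {w : X → Plane}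
    (hV : Continuous V) (hw : Continuous w) : Continuous fun x => alongCoord (V x) (w x) := by
  unfold _root_.alongCoord
  fun_prop

@[fun_prop]
theorem Continuous.acrossCoord {X : Type*} [TopologicalSpace X] {V : X → ℝ} {w : X → Plane}
    (hV : Continuous V) (hw : Continuous w) : Continuous fun x => acrossCoord (V x) (w x) := by
  unfold _root_.acrossCoord
  fun_prop

theorem Continuous.ellipseForm {X : Type*} [TopologicalSpace X] {s : X → EllipseParam}
    {w : X → Plane} (hs : Continuous s) (hw : Continuous w) :
    Continuous fun x => ellipseForm (s x) (w x) := by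
  unfold _root_.ellipseForm
  have h : ∀ x, (((s x).2.1 : Set.Ici (1 : ℝ)) : ℝ) ≠ 0 := fun x =>
    (zero_lt_one.trans_le (one_le_majorAxis (s x))).ne'
  fun_prop (disch := exact h _)

theorem alongCoord_sub (V : ℝ) (w z : Plane) :
    alongCoord V (w - z) = alongCoord V w - alongCoord V z := by
  simp [alongCoord]
  ring

theorem acrossCoord_sub (V : ℝ) (w z : Plane) :
    acrossCoord V (w - z) = acrossCoord V w - acrossCoord V z := by
  simp [acrossCoord]
  ring

theorem alongCoord_sq_add_acrossCoord_sq (V : ℝ) (w : Plane) :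
    alongCoord V w ^ 2 + acrossCoord V w ^ 2 = ‖w‖ ^ 2 := by
  rw [EuclideanSpace.norm_sq_eq]
  simp only [alongCoord, acrossCoord, Fin.sum_univ_two, Real.norm_eq_abs, sq_abs]
  linear_combination (w 0 ^ 2 + w 1 ^ 2) * Real.sin_sq_add_cos_sq V

theorem abs_alongCoord_le (V : ℝ) (w : Plane) : |alongCoord V w| ≤ ‖w‖ := by
  refine abs_le_of_sq_le_sq ?_ (norm_nonneg _)
  rw [← alongCoord_sq_add_acrossCoord_sq V w]
  exact le_add_of_nonneg_right (sq_nonneg _)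

theorem abs_acrossCoord_le (V : ℝ) (w : Plane) : |acrossCoord V w| ≤ ‖w‖ := by
  refine abs_le_of_sq_le_sq ?_ (norm_nonneg _)
  rw [← alongCoord_sq_add_acrossCoord_sq V w]
  exact le_add_of_nonneg_left (sq_nonneg _)

theorem abs_alongCoord_sub_center_le {s : EllipseParam} {w : Plane} (hw : w ∈ ellipse s) :
    |alongCoord s.2.2 (w - s.1)| ≤ s.2.1 := by
  have hR := zero_lt_one.trans_le (one_le_majorAxis s)
  rw [mem_ellipse_iff, ellipseForm] at hw
  have h1 : (alongCoord s.2.2 (w - s.1) / (s.2.1 : ℝ)) ^ 2 ≤ 1 ^ 2 := by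
    linarith [sq_nonneg (acrossCoord s.2.2 (w - s.1))]
  have h2 := abs_le_of_sq_le_sq h1 zero_le_one
  rwa [abs_div, abs_of_pos hR, div_le_one hR] at h2

theorem abs_acrossCoord_sub_center_le {s : EllipseParam} {w : Plane} (hw : w ∈ ellipse s) :
    |acrossCoord s.2.2 (w - s.1)| ≤ 1 := by
  rw [mem_ellipse_iff, ellipseForm] at hw
  refine abs_le_of_sq_le_sq ?_ zero_le_one
  linarith [sq_nonneg (alongCoord s.2.2 (w - s.1) / (s.2.1 : ℝ))]

theorem norm_sub_center_le {s : EllipseParam} {w : Plane} (hw : w ∈ ellipse s) :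
    ‖w - s.1‖ ≤ s.2.1 := by
  have hR1 := one_le_majorAxis s
  have hR := zero_lt_one.trans_le hR1
  rw [mem_ellipse_iff, ellipseForm, div_pow] at hw
  refine le_of_sq_le_sq ?_ hR.le
  rw [← alongCoord_sq_add_acrossCoord_sq s.2.2]
  have hR2 : 1 ≤ (s.2.1 : ℝ) ^ 2 := one_le_pow₀ hR1
  have h1 : alongCoord s.2.2 (w - s.1) ^ 2 =
      alongCoord s.2.2 (w - s.1) ^ 2 / (s.2.1 : ℝ) ^ 2 * (s.2.1 : ℝ) ^ 2 := by
    field_simp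
  have h2 := le_mul_of_one_le_right (sq_nonneg (acrossCoord s.2.2 (w - s.1))) hR2
  have h3 := mul_le_mul_of_nonneg_right hw (zero_le_one.trans hR2)
  rw [add_mul] at h3
  linarith

/-- Projection along a compact factor is a closed map. -/
theorem isClosed_touching_of_isCompact {K : Set Plane} (hK : IsCompact K) :
    IsClosed (touching K) := by
  have := isCompact_iff_compactSpace.1 hK
  have h : touching K =
      Prod.snd '' {p : K × EllipseParam | ellipseForm p.2 (p.1 : Plane) ≤ 1} := by
    ext s
    constructor
    · rintro ⟨w, hw, hwK⟩
      exact ⟨(⟨w, hwK⟩, s), mem_ellipse_iff.1 hw, rfl⟩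
    · rintro ⟨⟨w, s'⟩, hw, rfl⟩
      exact ⟨w, mem_ellipse_iff.2 hw, w.2⟩
  rw [h]
  have hc : Continuous fun p : K × EllipseParam => ellipseForm p.2 (p.1 : Plane) :=
    continuous_snd.ellipseForm (continuous_subtype_val.comp continuous_fst)
  have hcl : IsClosed {p : K × EllipseParam | ellipseForm p.2 (p.1 : Plane) ≤ 1} :=
    isClosed_Iic.preimage hc
  exact isClosedMap_snd_of_compactSpace _ hcl

theorem ellipseForm_lineMap (s : EllipseParam) (w : Plane) (t : ℝ) :
    ellipseForm s (s.1 + t • (w - s.1)) = t ^ 2 * ellipseForm s w := by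
  simp [ellipseForm, alongCoord, acrossCoord]
  ring

/-- Contracting a common point slightly towards the centre keeps it in the open set `K` and makes
the form strictly less than `1`, which is an open condition on the parameter. -/
theorem isOpen_touching_of_isOpen {K : Set Plane} (hK : IsOpen K) : IsOpen (touching K) := by
  have h : touching K =
      ⋃ w ∈ K, {s : EllipseParam | ellipseForm s w < 1} := by
    ext s
    simp only [Set.mem_iUnion, Set.mem_ofPred_eq, exists_prop]
    constructor
    · rintro ⟨w, hw, hwK⟩
      rw [mem_ellipse_iff] at hw
      have hc : Continuous fun t : ℝ => s.1 + t • (w - s.1) := by fun_prop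
      have h1 : ∀ᶠ t in nhdsWithin (1 : ℝ) (Set.Iio 1), s.1 + t • (w - s.1) ∈ K := by
        refine (hc.tendsto 1).eventually_mem ?_ |>.filter_mono nhdsWithin_le_nhds
        simpa using hK.mem_nhds hwK
      have h2 : ∀ᶠ t in nhdsWithin (1 : ℝ) (Set.Iio 1), t ∈ Set.Ioo (0 : ℝ) 1 :=
        Ioo_mem_nhdsLT zero_lt_one
      obtain ⟨t, htK, ht0, ht1⟩ := (h1.and h2).exists
      refine ⟨_, htK, ?_⟩
      rw [ellipseForm_lineMap]
      have ht : t ^ 2 < 1 := pow_lt_one₀ ht0.le ht1 two_ne_zero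
      nlinarith [sq_nonneg t]
    · rintro ⟨w, hwK, hw⟩
      exact ⟨w, mem_ellipse_iff.2 hw.le, hwK⟩
  rw [h]
  refine isOpen_biUnion fun w _ => ?_
  have hc : Continuous fun s : EllipseParam => ellipseForm s w :=
    continuous_id.ellipseForm continuous_const
  exact isOpen_Iio.preimage hc

/-- The ellipses of major semi-axis at least `r` whose centre lies in a rectangle that contains
every centre of an ellipse touching the ball of radius `l`. -/
def longNear (l r : ℝ) : Set EllipseParam :=
  {s | r ≤ (s.2.1 : ℝ) ∧ |alongCoord s.2.2 s.1| ≤ s.2.1 + l ∧ |acrossCoord s.2.2 s.1| ≤ 1 + l}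

/-- The ellipse lies within distance `R` of its centre, so two of its points are at most `2 R`
apart. The centre's coordinates along the axes differ from those of a point of the inner ball by at
most `R` and `1`. -/
theorem touching_inter_touching_subset (l₁ l₂ : ℝ) :
    touching (Metric.closedBall 0 l₁) ∩ touching (Metric.closedBall 0 l₂)ᶜ ⊆
      longNear l₁ ((l₂ - l₁) / 2) := by
  rintro s ⟨⟨w, hw, hwK⟩, ⟨w', hw', hwK'⟩⟩
  rw [mem_closedBall_zero_iff] at hwK
  rw [Set.mem_compl_iff, mem_closedBall_zero_iff, not_le] at hwK'
  refine ⟨?_, ?_, ?_⟩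
  · have h1 := norm_sub_center_le hw
    have h2 := norm_sub_center_le hw'
    have h3 : ‖w'‖ ≤ ‖w' - s.1‖ + ‖w - s.1‖ + ‖w‖ := by
      calc ‖w'‖ = ‖(w' - s.1) - (w - s.1) + w‖ := by congr 1; abel
        _ ≤ _ := (norm_add_le _ _).trans (add_le_add_left (norm_sub_le _ _) _)
    linarith
  · have h1 := abs_alongCoord_sub_center_le hw
    have h2 := (abs_alongCoord_le s.2.2 w).trans hwK
    rw [alongCoord_sub] at h1
    rw [abs_le] at *
    constructor <;> linarith
  · have h1 := abs_acrossCoord_sub_center_le hw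
    have h2 := (abs_acrossCoord_le s.2.2 w).trans hwK
    rw [acrossCoord_sub] at h1
    rw [abs_le] at *
    constructor <;> linarith

theorem measurableSet_longNear (l r : ℝ) : MeasurableSet (longNear l r) := by
  have h : IsClosed (longNear l r) := by
    have h₁ : IsClosed {s : EllipseParam | r ≤ (s.2.1 : ℝ)} :=
      isClosed_le (by fun_prop) (by fun_prop)
    have h₂ : IsClosed {s : EllipseParam | |alongCoord s.2.2 s.1| ≤ s.2.1 + l} :=
      isClosed_le (by fun_prop) (by fun_prop)
    have h₃ : IsClosed {s : EllipseParam | |acrossCoord s.2.2 s.1| ≤ 1 + l} :=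
      isClosed_le (by fun_prop) (by fun_prop)
    exact h₁.inter (h₂.inter h₃)
  exact h.measurableSet

/-- The set is the preimage of a box under a rotation, whose determinant is `1`. -/
theorem volume_rotated_rectangle (V A B : ℝ) :
    volume {z : Plane | |alongCoord V z| ≤ A ∧ |acrossCoord V z| ≤ B} =
      ENNReal.ofReal (2 * A) * ENNReal.ofReal (2 * B) := by
  let M : Matrix (Fin 2) (Fin 2) ℝ :=
    !![Real.cos V, Real.sin V; -Real.sin V, Real.cos V]
  have hdet : M.det = 1 := by
    simp only [M, Matrix.det_fin_two_of]
    linear_combination Real.sin_sq_add_cos_sq V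
  have hmap := Real.map_matrix_volume_pi_eq_smul_volume_pi (M := M) (by rw [hdet]; exact one_ne_zero)
  rw [hdet] at hmap
  simp only [inv_one, abs_one, ENNReal.ofReal_one, one_smul] at hmap
  have hbox : volume (Set.Icc ![-A, -B] ![A, B]) =
      ENNReal.ofReal (2 * A) * ENNReal.ofReal (2 * B) := by
    rw [Real.volume_Icc_pi]
    simp [Fin.prod_univ_two, two_mul]
  have hM : Measurable (Matrix.toLin' M) :=
    (LinearMap.continuous_of_finiteDimensional (Matrix.toLin' M)).measurable
  rw [← hbox, ← hmap, Measure.map_apply hM measurableSet_Icc,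
    ← (PiLp.volume_preserving_ofLp (Fin 2)).measure_preimage
      (hM measurableSet_Icc).nullMeasurableSet]
  congr 1
  ext z
  simp [alongCoord, acrossCoord, M, dotProduct, Pi.le_def, Fin.forall_fin_two,
    abs_le, Fin.sum_univ_two, mul_comm]
  tauto

end EllipseGeometry

/-! ### The intensity of long ellipses near the ball. -/

section Intensity

instance isProbabilityMeasure_directionLaw : IsProbabilityMeasure directionLaw := by
  constructor
  rw [directionLaw, Measure.smul_apply, comap_subtype_coe_apply measurableSet_Ioc,
    Set.image_univ, Subtype.range_coe, Real.volume_Ioc, smul_eq_mul]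
  have h : Real.pi / 2 - -(Real.pi / 2) = Real.pi := by ring
  rw [h]
  exact ENNReal.inv_mul_cancel (by simpa using Real.pi_pos) ENNReal.ofReal_ne_top

/-- A power tail bounds the truncated first moment. -/
theorem HasTailDecay.setLIntegral_le {ρ : Measure (Set.Ici (1 : ℝ))} [IsProbabilityMeasure ρ]
    {α c : ℝ} (h : HasTailDecay ρ α c) (hα : 1 < α) (hc : 0 < c) {r : ℝ} (hr : 1 ≤ r) :
    ∫⁻ x in {x : Set.Ici (1 : ℝ) | r ≤ (x : ℝ)}, ENNReal.ofReal x ∂ρ ≤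
      ENNReal.ofReal (c * (α / (α - 1)) * r ^ (1 - α)) := by
  have hr0 : 0 < r := zero_lt_one.trans_le hr
  have tail : ∀ t : ℝ, 1 ≤ t → ρ {x | t ≤ (x : ℝ)} ≤ ENNReal.ofReal (c * t ^ (-α)) := by
    intro t ht
    rw [← ofReal_measureReal]
    exact ENNReal.ofReal_le_ofReal (h t ht).2
  have hm : ∀ t : ℝ, MeasurableSet {x : Set.Ici (1 : ℝ) | t ≤ (x : ℝ)} := fun t =>
    measurableSet_le measurable_const measurable_subtype_coe
  -- Layer-cake formula, split at `r`: below `r` the tail is frozen at its value at `r`, above it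
  -- the power bound is integrated. The factors `1` and `1 / (α - 1)` add up to `α / (α - 1)`.
  rw [lintegral_eq_lintegral_meas_le (f := fun x : Set.Ici (1 : ℝ) => (x : ℝ)) _
    (ae_of_all _ fun x => zero_le_one.trans x.2) measurable_subtype_coe.aemeasurable, ← Set.Ioc_union_Ioi_eq_Ioi hr0.le,
    lintegral_union measurableSet_Ioi Set.Ioc_disjoint_Ioi_same]
  have near : ∫⁻ t in Set.Ioc 0 r,
      (ρ.restrict {x : Set.Ici (1 : ℝ) | r ≤ (x : ℝ)}) {x | t ≤ (x : ℝ)} ≤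
        ENNReal.ofReal (c * r ^ (1 - α)) := by
    calc _ ≤ ∫⁻ t in Set.Ioc 0 r, ENNReal.ofReal (c * r ^ (-α)) := by
          refine lintegral_mono fun t => ?_
          rw [Measure.restrict_apply (hm t)]
          exact (measure_mono Set.inter_subset_right).trans (tail r hr)
      _ = ENNReal.ofReal (c * r ^ (1 - α)) := by
          rw [setLIntegral_const, Real.volume_Ioc, sub_zero,
            ← ENNReal.ofReal_mul (by positivity), sub_eq_add_neg 1 α, Real.rpow_add hr0,
            Real.rpow_one]
          congr 1
          ring
  have far : ∫⁻ t in Set.Ioi r,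
      (ρ.restrict {x : Set.Ici (1 : ℝ) | r ≤ (x : ℝ)}) {x | t ≤ (x : ℝ)} ≤
        ENNReal.ofReal (c * (1 / (α - 1)) * r ^ (1 - α)) := by
    calc _ ≤ ∫⁻ t in Set.Ioi r, ENNReal.ofReal (c * t ^ (-α)) := by
          refine setLIntegral_mono' measurableSet_Ioi fun t ht => ?_
          rw [Measure.restrict_apply (hm t)]
          exact (measure_mono Set.inter_subset_left).trans (tail t (hr.trans (le_of_lt ht)))
      _ = ENNReal.ofReal (c * (1 / (α - 1)) * r ^ (1 - α)) := by
          rw [← ofReal_integral_eq_lintegral_ofReal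
            ((integrableOn_Ioi_rpow_of_lt (by linarith) hr0).const_mul c), integral_const_mul,
            integral_Ioi_rpow_of_lt (by linarith) hr0]
          · congr 1
            have h1 : -α + 1 = -(α - 1) := by ring
            have h2 : 1 - α = -(α - 1) := by ring
            rw [h1, h2, neg_div_neg_eq]
            ring
          · filter_upwards [ae_restrict_mem measurableSet_Ioi] with t ht
            have : 0 < t := hr0.trans ht
            positivity
  refine (add_le_add near far).trans ?_
  have hα' : 0 < α - 1 := by linarith
  rw [← ENNReal.ofReal_add (by positivity) (by positivity)]
  refine ENNReal.ofReal_le_ofReal (le_of_eq ?_)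
  field_simp
  ring

theorem ellipsesIntensity_longNear_le {ρ : Measure (Set.Ici (1 : ℝ))} [IsProbabilityMeasure ρ]
    {α c : ℝ} (h : HasTailDecay ρ α c) (hα : 1 < α) (hc : 0 < c) {u : ℝ} (hu : 0 < u) {l r : ℝ}
    (hl : 1 ≤ l) (hr : l ≤ r) :
    ellipsesIntensity u ρ (longNear l r) ≤
      ENNReal.ofReal (16 * u * l * (c * (α / (α - 1)) * r ^ (1 - α))) := by
  have hm : MeasurableSet {x : Set.Ici (1 : ℝ) | r ≤ (x : ℝ)} :=
    measurableSet_le measurable_const measurable_subtype_coe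
  set g : Set.Ici (1 : ℝ) → ℝ≥0∞ := Set.indicator {x : Set.Ici (1 : ℝ) | r ≤ (x : ℝ)}
    fun x => ENNReal.ofReal (16 * u * l) * ENNReal.ofReal (x : ℝ) with hg
  have hgm : Measurable g := Measurable.indicator (by fun_prop) hm
  rw [ellipsesIntensity, Measure.prod_apply_symm (measurableSet_longNear l r)]
  calc ∫⁻ y, (ENNReal.ofReal u • (volume : Measure Plane)) ((fun z => (z, y)) ⁻¹' longNear l r)
        ∂(ρ.prod directionLaw)
      ≤ ∫⁻ y, g y.1 ∂(ρ.prod directionLaw) := by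
        refine lintegral_mono fun y => ?_
        rw [Measure.smul_apply, smul_eq_mul]
        by_cases hy : r ≤ (y.1 : ℝ)
        · have hsub : (fun z => (z, y)) ⁻¹' longNear l r ⊆
              {z : Plane | |alongCoord y.2 z| ≤ y.1 + l ∧ |acrossCoord y.2 z| ≤ 1 + l} :=
            fun z hz => hz.2
          have hy0 : (0 : ℝ) ≤ y.1 := zero_le_one.trans y.1.2
          have hgy : g y.1 = ENNReal.ofReal (16 * u * l) * ENNReal.ofReal (y.1 : ℝ) :=
            Set.indicator_of_mem (s := {x : Set.Ici (1 : ℝ) | r ≤ (x : ℝ)}) hy _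
          rw [hgy]
          refine (mul_le_mul_right (measure_mono hsub) _).trans ?_
          rw [volume_rotated_rectangle, ← ENNReal.ofReal_mul (by positivity),
            ← ENNReal.ofReal_mul hu.le, ← ENNReal.ofReal_mul (by positivity)]
          refine ENNReal.ofReal_le_ofReal ?_
          -- Here `l ≤ r ≤ R` absorbs `l` into the long side, and `1 ≤ l` absorbs the `1` into the
          -- short one.
          have h1 : 2 * ((y.1 : ℝ) + l) ≤ 4 * y.1 := by linarith
          have h2 : 2 * (1 + l) ≤ 4 * l := by linarith
          have h3 := mul_le_mul h1 h2 (by linarith) (by linarith)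
          have h4 := mul_le_mul_of_nonneg_left h3 hu.le
          linarith
        · have he : (fun z => (z, y)) ⁻¹' longNear l r = ∅ := by
            ext z
            simp [longNear, hy]
          rw [he, measure_empty, mul_zero]
          exact zero_le
    _ = ∫⁻ x, g x ∂ρ := by
        have hgm' : Measurable fun y : Set.Ici (1 : ℝ) × Set.Ioc (-(Real.pi / 2)) (Real.pi / 2) =>
          g y.1 := hgm.comp measurable_fst
        rw [lintegral_prod _ hgm'.aemeasurable]
        simp
    _ = ENNReal.ofReal (16 * u * l) *
          ∫⁻ x in {x : Set.Ici (1 : ℝ) | r ≤ (x : ℝ)}, ENNReal.ofReal x ∂ρ := by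
        rw [hg, lintegral_indicator hm, lintegral_const_mul _ (by fun_prop)]
    _ ≤ _ := by
        rw [ENNReal.ofReal_mul (p := 16 * u * l) (by positivity)]
        exact mul_le_mul_right (h.setLIntegral_le hα hc (hl.trans hr)) _

end Intensity

/-! ### Assembly of the decoupling inequality. -/

theorem mainTheorem7 (α : ℝ) (hα : 1 < α) (c : ℝ) (hc : 0 < c) :
    ∃ C : ℝ, 0 < C ∧
      ∀ (u : ℝ), 0 < u →
      ∀ (ρ : Measure (Set.Ici (1 : ℝ))), IsProbabilityMeasure ρ → HasTailDecay ρ α c →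
      ∀ (Ω : Type*) [MeasurableSpace Ω] (P : Measure Ω) [IsProbabilityMeasure P]
        (ξ : Ω → PointConfig EllipseParam), IsEllipsesModel ξ u ρ P →
      ∀ (l₁ l₂ a : ℝ), 1 ≤ l₁ → 3 ≤ a → l₂ = a * l₁ →
      ∀ (f₁ f₂ : PointConfig EllipseParam → ℝ), Measurable f₁ → Measurable f₂ →
        (∀ m, |f₁ m| ≤ 1) → (∀ m, |f₂ m| ≤ 1) →
        DependsOnlyOnTouching f₁ (Metric.closedBall 0 l₁) →
        DependsOnlyOnTouching f₂ (Metric.closedBall 0 l₂)ᶜ →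
        |(∫ ω, f₁ (ξ ω) * f₂ (ξ ω) ∂P) - (∫ ω, f₁ (ξ ω) ∂P) * (∫ ω, f₂ (ξ ω) ∂P)|
          ≤ u * C * l₁ ^ (2 - α) * (a - 1) ^ (1 - α) := by
  have hα' : 0 < α - 1 := by linarith
  -- `96 = 6 * 16`, from the covariance bound and the rectangle area. The power of `1 / 2` comes
  -- from halving `l₂ - l₁`.
  refine ⟨96 * (c * (α / (α - 1))) * (1 / 2) ^ (1 - α), by positivity, ?_⟩
  intro u hu ρ hρ hdecay Ω _ P _ ξ hξ l₁ l₂ a hl ha hl₂ f₁ f₂ hf₁ hf₂ hb₁ hb₂ hd₁ hd₂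
  have hl0 : 0 < l₁ := zero_lt_one.trans_le hl
  have ha0 : 0 < a - 1 := by linarith
  have hr : (l₂ - l₁) / 2 = l₁ * (a - 1) * (1 / 2) := by rw [hl₂]; ring
  -- This is where `a ≥ 3` enters.
  have hlr : l₁ ≤ (l₂ - l₁) / 2 := by rw [hr]; nlinarith
  have hbound := (measure_mono (touching_inter_touching_subset l₁ l₂)).trans
    (ellipsesIntensity_longNear_le hdecay hα hc hu hl hlr)
  refine (hξ.abs_covariance_le
    (isClosed_touching_of_isCompact (isCompact_closedBall 0 l₁)).measurableSet
    (isOpen_touching_of_isOpen Metric.isClosed_closedBall.isOpen_compl).measurableSet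
    (hbound.trans_lt ENNReal.ofReal_lt_top) hf₁ hf₂ hb₁ hb₂ hd₁ hd₂).trans ?_
  have hr0 : 0 < (l₂ - l₁) / 2 := hl0.trans_le hlr
  have h1 := ENNReal.toReal_le_of_le_ofReal (by positivity) hbound
  refine (mul_le_mul_of_nonneg_left h1 (by norm_num)).trans (le_of_eq ?_)
  have h2 : l₁ ^ (2 - α) = l₁ * l₁ ^ (1 - α) := by
    rw [show 2 - α = 1 + (1 - α) by ring, Real.rpow_add hl0, Real.rpow_one]
  rw [hr, Real.mul_rpow (by positivity) (by norm_num), Real.mul_rpow hl0.le ha0.le, h2]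
  ring
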